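/- **Setting.** Let $1\le m\le d$ be integers. A *semi-bandit problem* consists of a non-empty set $\mathcal A$ of actions, each action being a set of exactly $m$ of the $d$ arms, and of a probability law on $\mathbb R^d$ with mean $\mu$. The reward vectors $X_1,X_2,\dots$ are i.i.d. with this law. At each stage $t\ge 1$ an algorithm, which knows $\mathcal A$, chooses $A_t\in\mathcal A$ as a measurable function of the past actions, of the past observations $(X_s^{(i)})_{i\in A_s}$, $s<t$, and possibly of an internal random seed independent of the rewards. The gap of $A\in\mathcal A$ is $\Delta_A=\max_{B\in\mathcal A}\sum_{i\in B}\mu^{(i)}-\sum_{i\in A}\mu^{(i)}$, and the expected regret is $\mathbb E R_T=\mathbb E\sum_{t=1}^T\Delta_{A_t}$. For $\sigma>0$ and $\gamma\in[0,1]$, the problem is said to have *$\sigma$-subgaussian arms and correlation coefficients at most $\gamma$* if there is a positive semi-definite matrix $C$ with $\mathbb E\, e^{u^\top(X_1-\mu)}\le e^{\frac12u^\top Cu}$ for all $u\in\mathbb R^d$, with $C^{(ii)}\le\sigma^2$ for all $i$, and with $C^{(ij)}/\sqrt{C^{(ii)}C^{(jj)}}\le\gamma$ for all $i\ne j$ (where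 $0/0=0$). An algorithm is *consistent* if, on every problem with $\sigma$-subgaussian arms and correlation coefficients at most $\gamma$, $\mathbb E R_t=o(t^a)$ as $t\to+\infty$ for all $a>0$. **Theorem 1 (lower bound).** Suppose that $d$ is a multiple of $m$, and let $\sigma>0$ and $\gamma\in[0,1]$. Then for any $\Delta>0$ and any consistent algorithm, there is a semi-bandit problem with $\sigma$-subgaussian arms and correlation coefficients at most $\gamma$, all of whose gaps are $\Delta$ (that is, $\Delta_A\in\{0,\Delta\}$ for every $A\in\mathcal A$), on which $$\liminf_{t\to+\infty}\frac{\mathbb E R_t}{\log t}\;\ge\;(1+\gamma(m-1))\,\frac{2\sigma^2(d-m)}{\Delta}.$$ -/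

import Mathlib

open MeasureTheory Filter Matrix

namespace SemiBandit

/-- A non-empty family of admissible actions, each a set of exactly `m` arms among `d`. -/
structure ActionSet (d m : ℕ) where
  actions : Finset (Finset (Fin d))
  nonempty : actions.Nonempty
  card_eq : ∀ A ∈ actions, A.card = m

/-- A stochastic semi-bandit problem: the admissible actions, and the common law of the
i.i.d. reward vectors of the `d` arms. -/
structure Problem (d m : ℕ) where
  actionSet : ActionSet d m
  law : Measure (Fin d → ℝ)
  isProb : IsProbabilityMeasure law

/-- What is recorded at one stage: the action played and the reward vector restricted to the
arms of that action (the other coordinates are replaced by `0`). -/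
abbrev Observation (d : ℕ) : Type := Finset (Fin d) × (Fin d → ℝ)

/-- The semi-bandit feedback for action `A` when the reward vector is `x`. -/
def observe {d : ℕ} (A : Finset (Fin d)) (x : Fin d → ℝ) : Observation d :=
  (A, fun i => if i ∈ A then x i else 0)

/-- A (possibly randomized) algorithm for problems with `d` arms and actions of size `m`. It is
told the admissible actions. Its internal randomization is a seed in `S`, drawn once and
independently of the rewards. After `t` stages it chooses the next action as a measurable
function of the seed and of the observations of these `t` stages. -/
structure Algorithm (d m : ℕ) (S : Type*) [MeasurableSpace S] where
  seedLaw : Measure S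
  isProb : IsProbabilityMeasure seedLaw
  act : ActionSet d m → (t : ℕ) → S × (Fin t → Observation d) → Finset (Fin d)
  measurable_act : ∀ (𝒜 : ActionSet d m) (t : ℕ), Measurable (act 𝒜 t)
  act_mem : ∀ (𝒜 : ActionSet d m) (t : ℕ) (h : S × (Fin t → Observation d)),
    act 𝒜 t h ∈ 𝒜.actions

section Problem

variable {d m : ℕ}

/-- The mean reward of each arm. -/
noncomputable def Problem.mean (p : Problem d m) : Fin d → ℝ :=
  fun i => ∫ x, x i ∂p.law

/-- The mean reward of an action. -/
noncomputable def Problem.value (p : Problem d m) (A : Finset (Fin d)) : ℝ :=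
  ∑ i ∈ A, p.mean i

/-- The gap of an action: the mean reward of a best admissible action minus that of `A`. -/
noncomputable def Problem.gap (p : Problem d m) (A : Finset (Fin d)) : ℝ :=
  p.actionSet.actions.sup' p.actionSet.nonempty p.value - p.value A

/-- `C` is a subgaussian covariance matrix of the noise `X - μ`: it is positive semi-definite
and `E exp (uᵀ (X - μ)) ≤ exp (uᵀ C u / 2)` for all `u`. -/
def Problem.IsSubgaussianCov (p : Problem d m) (C : Matrix (Fin d) (Fin d) ℝ) : Prop :=
  C.PosSemidef ∧ ∀ u : Fin d → ℝ,
    Integrable (fun x : Fin d → ℝ => Real.exp (u ⬝ᵥ (x - p.mean))) p.law ∧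
    ∫ x, Real.exp (u ⬝ᵥ (x - p.mean)) ∂p.law ≤ Real.exp ((u ⬝ᵥ (C *ᵥ u)) / 2)

/-- The problem has `σ`-subgaussian arms and correlation coefficients at most `γ`: there is a
subgaussian covariance matrix with diagonal at most `σ ^ 2` and all of whose off-diagonal
correlation coefficients are at most `γ`. -/
def Problem.IsSubgaussianWith (p : Problem d m) (σ γ : ℝ) : Prop :=
  ∃ C : Matrix (Fin d) (Fin d) ℝ, p.IsSubgaussianCov C ∧
    (∀ i, C i i ≤ σ ^ 2) ∧
    ∀ i j, i ≠ j → C i j / Real.sqrt (C i i * C j j) ≤ γ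

end Problem

section Run

variable {d m : ℕ} {S : Type*} [MeasurableSpace S]

/-- The observations of the first `t` stages when the algorithm faces the admissible actions `𝒜`,
has seed `ω.1`, and the successive reward vectors are `ω.2 0, ω.2 1, …`. -/
def Algorithm.history (π : Algorithm d m S) (𝒜 : ActionSet d m)
    (ω : S × (ℕ → Fin d → ℝ)) : (t : ℕ) → Fin t → Observation d
  | 0 => Fin.elim0
  | t + 1 => Fin.snoc (α := fun _ => Observation d) (π.history 𝒜 ω t)
      (observe (π.act 𝒜 t (ω.1, π.history 𝒜 ω t)) (ω.2 t))

/-- The action played after `t` stages, that is, at the stage numbered `t + 1`. -/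
def Algorithm.action (π : Algorithm d m S) (𝒜 : ActionSet d m) (t : ℕ)
    (ω : S × (ℕ → Fin d → ℝ)) : Finset (Fin d) :=
  π.act 𝒜 t (ω.1, π.history 𝒜 ω t)

/-- The joint law of the seed and of the i.i.d. reward vectors. -/
noncomputable def jointLaw (π : Algorithm d m S) (p : Problem d m) :
    Measure (S × (ℕ → Fin d → ℝ)) :=
  haveI := p.isProb
  π.seedLaw.prod (Measure.infinitePi fun _ : ℕ => p.law)

/-- The expected regret after `T` stages. -/
noncomputable def expectedRegret (π : Algorithm d m S) (p : Problem d m) (T : ℕ) : ℝ :=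
  ∫ ω, ∑ t ∈ Finset.range T, p.gap (π.action p.actionSet t ω) ∂(jointLaw π p)

/-- The algorithm is consistent for `σ`-subgaussian arms with correlation coefficients at most
`γ`: on every such problem its expected regret is `o(t ^ a)` for all `a > 0`. -/
def Algorithm.IsConsistent (π : Algorithm d m S) (σ γ : ℝ) : Prop :=
  ∀ p : Problem d m, p.IsSubgaussianWith σ γ → ∀ a : ℝ, 0 < a →
    (fun t : ℕ => expectedRegret π p t) =o[atTop] (fun t : ℕ => (t : ℝ) ^ a)

end Run

end SemiBandit

/-! Write `d = m * k` and let the actions be `k` disjoint blocks of `m` arms. The rewards are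
Gaussian, independent across blocks, with variance `σ ^ 2` and correlation `γ` inside a block. Block
`0` has mean `0` and every other arm has mean `-Δ / m`, so all suboptimal gaps equal `Δ`; this
problem does not depend on the algorithm. Fix a block `b ≠ 0` and a small `a > 0`. Raising the means
of `b` to `a * Δ / m` makes `b` the best action by at least `a * Δ`, and only plays of `b` reveal
the change. The vector constant on `b` is an eigenvector of the covariance with eigenvalue `σ ^ 2 *
(1 + γ * (m - 1))`, so each such play carries the divergence `Δ ^ 2 * (1 + a) ^ 2 / (2 * m * σ ^ 2 *
(1 + γ * (m - 1)))`: positive correlation makes a block less informative. Consistency on both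
problems forces `b` to be played rarely on the first and almost always on the second. By change of
measure (`lintegral_history_eq`), Wald's identity (`integral_logRatio`) and a Bretagnolle–Huber
inequality (`exp_neg_integral_pullCount_le`), the expected number of plays of `b` times this
divergence is at least `(1 - 2 * a) * log T` eventually. Summing the cost `Δ` over the `k - 1`
suboptimal blocks, where `m * (k - 1) = d - m`, and letting `a → 0` gives the constant. -/

/-! ### Gaussian vectors: moments and the Cameron–Martin formula. -/

section Gaussian

open ProbabilityTheory

/-- The standard Gaussian measure on a finite product of copies of `ℝ`. -/
noncomputable def stdGaussianPi (ι : Type*) [Fintype ι] : Measure (ι → ℝ) :=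
  Measure.pi fun _ => gaussianReal 0 1

variable {ι : Type*} [Fintype ι]

instance : IsProbabilityMeasure (stdGaussianPi ι) := by
  unfold stdGaussianPi; infer_instance

lemma exp_dotProduct_eq_prod (v g : ι → ℝ) :
    Real.exp (v ⬝ᵥ g) = ∏ i, Real.exp (v i * g i) := by
  rw [dotProduct, Real.exp_sum]

lemma integrable_exp_dotProduct_stdGaussianPi (v : ι → ℝ) :
    Integrable (fun g => Real.exp (v ⬝ᵥ g)) (stdGaussianPi ι) := by
  simp_rw [exp_dotProduct_eq_prod]
  exact Integrable.fintype_prod (f := fun i x => Real.exp (v i * x))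
    fun i => integrable_exp_mul_gaussianReal (v i)

lemma integral_exp_dotProduct_stdGaussianPi (v : ι → ℝ) :
    ∫ g, Real.exp (v ⬝ᵥ g) ∂stdGaussianPi ι = Real.exp ((v ⬝ᵥ v) / 2) := by
  simp_rw [exp_dotProduct_eq_prod]
  have h (i : ι) : ∫ x, Real.exp (v i * x) ∂gaussianReal 0 1 = Real.exp (v i ^ 2 / 2) := by
    have := congrFun (mgf_id_gaussianReal (μ := 0) (v := 1)) (v i)
    simpa [mgf] using this
  rw [stdGaussianPi, integral_fintype_prod_eq_prod (fun i x => Real.exp (v i * x))]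
  simp_rw [h]
  rw [← Real.exp_sum, dotProduct, Finset.sum_div]
  simp_rw [sq]

lemma integrable_eval_stdGaussianPi (i : ι) :
    Integrable (fun g : ι → ℝ => g i) (stdGaussianPi ι) :=
  integrable_comp_eval (f := id) ((memLp_id_gaussianReal 1).integrable (by simp))

lemma integral_eval_stdGaussianPi (i : ι) : ∫ g, g i ∂stdGaussianPi ι = 0 := by
  have h := integral_comp_eval (μ := fun _ : ι => gaussianReal 0 1) (i := i) (f := id)
    (measurable_id.aestronglyMeasurable)
  simpa [stdGaussianPi] using h

/-- Tilting a one-dimensional Gaussian translates it. -/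
lemma gaussianReal_apply_eq_setIntegral_exp (v : ℝ) (s : Set ℝ) (hs : MeasurableSet s) :
    (gaussianReal v 1).real s =
      ∫ x, s.indicator (fun x => Real.exp (v * x - v ^ 2 / 2)) x ∂gaussianReal 0 1 := by
  rw [integral_gaussianReal_eq_integral_smul (by simp),
    measureReal_def, gaussianReal_apply_eq_integral _ (by simp), ENNReal.toReal_ofReal
      (setIntegral_nonneg hs fun _ _ => gaussianPDFReal_nonneg _ _ _), ← integral_indicator hs]
  congr 1 with x
  by_cases hx : x ∈ s
  · simp only [hx, Set.indicator_of_mem, gaussianPDFReal, smul_eq_mul, mul_assoc, ← Real.exp_add]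
    congr 2
    simp only [NNReal.coe_one]
    ring_nf
  · simp [hx]

/-- Both the translated measure and the density factorize over coordinates, so comparing them on
boxes reduces to dimension one. -/
lemma stdGaussianPi_map_add (v : ι → ℝ) :
    (stdGaussianPi ι).map (fun g => v + g) =
      (stdGaussianPi ι).withDensity fun g => ENNReal.ofReal (Real.exp (v ⬝ᵥ g - (v ⬝ᵥ v) / 2)) := by
  have h1 : (stdGaussianPi ι).map (fun g => v + g) = Measure.pi fun i => gaussianReal (v i) 1 := by
    have := Measure.pi_map_pi (μ := fun _ : ι => gaussianReal 0 1) (f := fun i x => v i + x)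
      (fun i => by fun_prop)
    simp only [gaussianReal_map_const_add, zero_add] at this
    exact this
  rw [h1]
  refine Measure.pi_eq fun s hs => ?_
  have hbox : MeasurableSet (Set.univ.pi s) := MeasurableSet.univ_pi hs
  have hint : Integrable (fun g => Real.exp (v ⬝ᵥ g - (v ⬝ᵥ v) / 2)) (stdGaussianPi ι) := by
    simp_rw [Real.exp_sub]
    exact (integrable_exp_dotProduct_stdGaussianPi v).div_const _
  rw [withDensity_apply _ hbox, ← ofReal_integral_eq_lintegral_ofReal hint.integrableOn
    (ae_of_all _ fun _ => (Real.exp_pos _).le), ← integral_indicator hbox]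
  have hprod (g : ι → ℝ) :
      (Set.univ.pi s).indicator (fun g => Real.exp (v ⬝ᵥ g - (v ⬝ᵥ v) / 2)) g =
        ∏ i, (s i).indicator (fun x => Real.exp (v i * x - v i ^ 2 / 2)) (g i) := by
    by_cases hg : g ∈ Set.univ.pi s
    · rw [Set.indicator_of_mem hg, Finset.prod_congr rfl fun i _ =>
        Set.indicator_of_mem (hg i (Set.mem_univ i)) _, ← Real.exp_sum]
      simp [dotProduct, Finset.sum_div, sq]
    · rw [Set.indicator_of_notMem hg]
      simp only [Set.mem_pi, Set.mem_univ, true_imp_iff, not_forall] at hg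
      obtain ⟨i, hi⟩ := hg
      exact (Finset.prod_eq_zero (Finset.mem_univ i) (Set.indicator_of_notMem hi _)).symm
  simp_rw [hprod]
  rw [stdGaussianPi, integral_fintype_prod_eq_prod (fun i x =>
    (s i).indicator (fun x => Real.exp (v i * x - v i ^ 2 / 2)) x)]
  simp_rw [← gaussianReal_apply_eq_setIntegral_exp _ _ (hs _)]
  rw [ENNReal.ofReal_prod_of_nonneg fun _ _ => measureReal_nonneg]
  simp

variable {n : Type*} [Fintype n]

/-- The Gaussian law with mean `μ` and covariance matrix `L * Lᵀ`. -/
noncomputable def gaussianLaw (L : Matrix n ι ℝ) (μ : n → ℝ) : Measure (n → ℝ) :=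
  (stdGaussianPi ι).map fun g => μ + L *ᵥ g

@[fun_prop]
lemma measurable_affine (L : Matrix n ι ℝ) (μ : n → ℝ) : Measurable fun g : ι → ℝ => μ + L *ᵥ g :=
  Continuous.measurable (by fun_prop)

instance (L : Matrix n ι ℝ) (μ : n → ℝ) : IsProbabilityMeasure (gaussianLaw L μ) :=
  Measure.isProbabilityMeasure_map (measurable_affine L μ).aemeasurable

lemma integrable_eval_gaussianLaw (L : Matrix n ι ℝ) (μ : n → ℝ) (i : n) :
    Integrable (fun x : n → ℝ => x i) (gaussianLaw L μ) := by
  rw [gaussianLaw, integrable_map_measure (measurable_pi_apply i).aestronglyMeasurable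
    (measurable_affine L μ).aemeasurable]
  refine (integrable_const _).add ?_
  exact integrable_finsetSum _ fun j _ => (integrable_eval_stdGaussianPi j).const_mul _

lemma integral_eval_gaussianLaw (L : Matrix n ι ℝ) (μ : n → ℝ) (i : n) :
    ∫ x, x i ∂gaussianLaw L μ = μ i := by
  rw [gaussianLaw, integral_map (measurable_affine L μ).aemeasurable
    (measurable_pi_apply i).aestronglyMeasurable]
  simp only [Pi.add_apply, mulVec, dotProduct]
  have hint (j : ι) : Integrable (fun g : ι → ℝ => L i j * g j) (stdGaussianPi ι) :=
    (integrable_eval_stdGaussianPi j).const_mul _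
  rw [integral_add (integrable_const _) (integrable_finsetSum _ fun j _ => hint j),
    integral_finsetSum _ fun j _ => hint j]
  simp [integral_const_mul, integral_eval_stdGaussianPi]

lemma dotProduct_mul_transpose_mulVec (L : Matrix n ι ℝ) (u : n → ℝ) :
    u ⬝ᵥ ((L * Lᵀ) *ᵥ u) = (u ᵥ* L) ⬝ᵥ (u ᵥ* L) := by
  rw [← mulVec_mulVec, dotProduct_mulVec, mulVec_transpose]

lemma integrable_exp_gaussianLaw (L : Matrix n ι ℝ) (μ u : n → ℝ) :
    Integrable (fun x => Real.exp (u ⬝ᵥ (x - μ))) (gaussianLaw L μ) := by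
  rw [gaussianLaw, integrable_map_measure (Continuous.aestronglyMeasurable (by fun_prop))
    (measurable_affine L μ).aemeasurable]
  simpa [Function.comp_def, dotProduct_mulVec] using
    integrable_exp_dotProduct_stdGaussianPi (u ᵥ* L)

lemma integral_exp_gaussianLaw (L : Matrix n ι ℝ) (μ u : n → ℝ) :
    ∫ x, Real.exp (u ⬝ᵥ (x - μ)) ∂gaussianLaw L μ =
      Real.exp ((u ⬝ᵥ ((L * Lᵀ) *ᵥ u)) / 2) := by
  rw [gaussianLaw, integral_map (measurable_affine L μ).aemeasurable
    (Continuous.aestronglyMeasurable (by fun_prop)), dotProduct_mul_transpose_mulVec,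
    ← integral_exp_dotProduct_stdGaussianPi]
  simp [dotProduct_mulVec]

/-- The Cameron–Martin formula for a possibly degenerate Gaussian law. -/
lemma gaussianLaw_add_eq_withDensity (L : Matrix n ι ℝ) (μ w : n → ℝ) :
    gaussianLaw L (μ + (L * Lᵀ) *ᵥ w) = (gaussianLaw L μ).withDensity fun x =>
      ENNReal.ofReal (Real.exp (w ⬝ᵥ (x - μ) - (w ⬝ᵥ ((L * Lᵀ) *ᵥ w)) / 2)) := by
  have hdens : Measurable fun x : n → ℝ =>
      ENNReal.ofReal (Real.exp (w ⬝ᵥ (x - μ) - (w ⬝ᵥ ((L * Lᵀ) *ᵥ w)) / 2)) := by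
    refine ENNReal.measurable_ofReal.comp (Continuous.measurable (by fun_prop))
  -- A mean shift in the range of `L * Lᵀ` comes from translating the standard Gaussian by `Lᵀ w`.
  -- No inverse of the covariance is needed, which covers the singular case `γ = 1`.
  have hshift : gaussianLaw L (μ + (L * Lᵀ) *ᵥ w) =
      ((stdGaussianPi ι).map (fun g => w ᵥ* L + g)).map fun g => μ + L *ᵥ g := by
    rw [Measure.map_map (measurable_affine L μ) (by fun_prop), gaussianLaw]
    congr 1
    ext g i
    simp [mulVec_add, ← mulVec_mulVec, mulVec_transpose, add_assoc]
  rw [hshift, stdGaussianPi_map_add]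
  ext s hs
  rw [Measure.map_apply (measurable_affine L μ) hs,
    withDensity_apply _ (measurable_affine L μ hs), withDensity_apply _ hs, gaussianLaw,
    setLIntegral_map hs hdens (measurable_affine L μ), dotProduct_mul_transpose_mulVec]
  simp [dotProduct_mulVec]

lemma gaussianLaw_map_add (L : Matrix n ι ℝ) (μ ν : n → ℝ) :
    (gaussianLaw L μ).map (fun x => x + ν) = gaussianLaw L (μ + ν) := by
  rw [gaussianLaw, Measure.map_map (by fun_prop) (measurable_affine L μ), gaussianLaw]
  congr 1
  ext g i
  simp only [Function.comp_def, Pi.add_apply]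
  ring

end Gaussian

/-! ### Interaction histories and change of measure. -/

namespace SemiBandit

/-- Replacing one coordinate of an i.i.d. sequence by an independent copy preserves the law. -/
lemma measurePreserving_update_infinitePi {E : Type*} [MeasurableSpace E] (μ : Measure E)
    [IsProbabilityMeasure μ] (T : ℕ) :
    MeasurePreserving (fun q : (ℕ → E) × E => Function.update q.1 T q.2)
      ((Measure.infinitePi fun _ : ℕ => μ).prod μ) (Measure.infinitePi fun _ : ℕ => μ) := by
  have hmeas : Measurable fun q : (ℕ → E) × E => Function.update q.1 T q.2 := measurable_update'
  refine ⟨hmeas, Measure.eq_infinitePi _ fun s t ht => ?_⟩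
  rw [Measure.map_apply hmeas (MeasurableSet.pi s.countable_toSet fun i _ => ht i)]
  have hpre : (fun q : (ℕ → E) × E => Function.update q.1 T q.2) ⁻¹' ((s : Set ℕ).pi t) =
      (((s.erase T : Finset ℕ) : Set ℕ).pi t) ×ˢ (if T ∈ s then t T else Set.univ) := by
    ext ⟨x, y⟩
    simp only [Set.mem_preimage, Set.mem_pi, Finset.mem_coe, Set.mem_prod, Finset.mem_erase]
    constructor
    · intro h
      refine ⟨fun i hi => by simpa [hi.1] using h i hi.2, ?_⟩
      split_ifs with hT
      · simpa using h T hT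
      · trivial
    · rintro ⟨h, hy⟩ i hi
      by_cases hiT : i = T
      · subst hiT
        simpa [hi] using hy
      · simpa [hiT] using h i ⟨hiT, hi⟩
  rw [hpre, Measure.prod_prod, Measure.infinitePi_pi _ fun i _ => ht i]
  split_ifs with hT
  · rw [Finset.prod_erase_mul s (fun i => μ (t i)) hT]
  · simp [Finset.erase_eq_of_notMem hT]

variable {d m : ℕ} {S : Type*} [MeasurableSpace S]

instance (p : Problem d m) : IsProbabilityMeasure p.law := p.isProb

instance (π : Algorithm d m S) : IsProbabilityMeasure π.seedLaw := π.isProb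

instance (π : Algorithm d m S) (p : Problem d m) : IsProbabilityMeasure (jointLaw π p) := by
  unfold jointLaw; infer_instance

/-- Replace the reward vector of the stage following the first `T` ones. -/
def resample (T : ℕ) (q : (S × (ℕ → Fin d → ℝ)) × (Fin d → ℝ)) : S × (ℕ → Fin d → ℝ) :=
  (q.1.1, Function.update q.1.2 T q.2)

/-- This plays the role of conditioning on the past: the action chosen after `T` stages ignores the
reward of index `T`, which can thus be integrated separately as a fresh independent copy. -/
lemma measurePreserving_resample (π : Algorithm d m S) (p : Problem d m) (T : ℕ) :
    MeasurePreserving (resample T) ((jointLaw π p).prod p.law) (jointLaw π p) :=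
  ((MeasurePreserving.id π.seedLaw).prod (measurePreserving_update_infinitePi p.law T)).comp
    (measurePreserving_prodAssoc π.seedLaw (Measure.infinitePi fun _ : ℕ => p.law) p.law)

lemma history_resample (π : Algorithm d m S) (𝒜 : ActionSet d m) (T : ℕ)
    (ω : S × (ℕ → Fin d → ℝ)) (x : Fin d → ℝ) {t : ℕ} (ht : t ≤ T) :
    π.history 𝒜 (resample T (ω, x)) t = π.history 𝒜 ω t := by
  induction t with
  | zero => rfl
  | succ t ih =>
    simp only [Algorithm.history, ih (by omega)]
    simp [resample, Function.update_of_ne (show t ≠ T by omega)]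

lemma action_resample (π : Algorithm d m S) (𝒜 : ActionSet d m) (T : ℕ)
    (ω : S × (ℕ → Fin d → ℝ)) (x : Fin d → ℝ) {t : ℕ} (ht : t ≤ T) :
    π.action 𝒜 t (resample T (ω, x)) = π.action 𝒜 t ω := by
  rw [Algorithm.action, history_resample π 𝒜 T ω x ht]
  rfl

lemma history_fst (π : Algorithm d m S) (𝒜 : ActionSet d m) (ω : S × (ℕ → Fin d → ℝ)) {t : ℕ}
    (s : Fin t) : (π.history 𝒜 ω t s).1 = π.action 𝒜 s ω := by
  induction t with
  | zero => exact s.elim0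
  | succ t ih =>
    refine Fin.lastCases ?_ (fun s => ?_) s
    · simp [Algorithm.history, observe, Algorithm.action]
    · simpa [Algorithm.history] using ih s

@[fun_prop]
lemma measurable_observe {Ω : Type*} [MeasurableSpace Ω] {A : Ω → Finset (Fin d)}
    {x : Ω → Fin d → ℝ} (hA : Measurable A) (hx : Measurable x) :
    Measurable fun ω => observe (A ω) (x ω) := by
  refine hA.prodMk (measurable_pi_iff.2 fun i => ?_)
  exact Measurable.ite (hA (MeasurableSet.of_discrete (s := {A | i ∈ A})))
    (measurable_pi_iff.1 hx i) measurable_const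

lemma measurable_snoc {Ω E : Type*} [MeasurableSpace Ω] [MeasurableSpace E] {t : ℕ}
    {h : Ω → Fin t → E} {e : Ω → E} (hh : Measurable h) (he : Measurable e) :
    Measurable fun ω => (Fin.snoc (α := fun _ => E) (h ω) (e ω) : Fin (t + 1) → E) := by
  refine measurable_pi_iff.2 fun i => ?_
  refine Fin.lastCases ?_ (fun s => ?_) i
  · simpa using he
  · simpa using measurable_pi_iff.1 hh s

@[fun_prop]
lemma measurable_history (π : Algorithm d m S) (𝒜 : ActionSet d m) (t : ℕ) :
    Measurable fun ω => π.history 𝒜 ω t := by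
  induction t with
  | zero => exact measurable_const
  | succ t ih =>
    exact measurable_snoc ih (measurable_observe
      ((π.measurable_act 𝒜 t).comp (measurable_fst.prodMk ih)) (by fun_prop))

@[fun_prop]
lemma measurable_action (π : Algorithm d m S) (𝒜 : ActionSet d m) (t : ℕ) :
    Measurable (π.action 𝒜 t) :=
  (π.measurable_act 𝒜 t).comp (measurable_fst.prodMk (measurable_history π 𝒜 t))

lemma measurableSet_action_eq (π : Algorithm d m S) (𝒜 : ActionSet d m) (t : ℕ)
    (b : Finset (Fin d)) : MeasurableSet {ω | π.action 𝒜 t ω = b} :=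
  measurable_action π 𝒜 t (measurableSet_singleton b)

/-- The logarithm of the likelihood ratio accumulated over the first `T` stages, when the action
`b` is the only informative one. -/
noncomputable def logRatio (π : Algorithm d m S) (𝒜 : ActionSet d m) (b : Finset (Fin d))
    (ℓ : (Fin d → ℝ) → ℝ) (T : ℕ) (ω : S × (ℕ → Fin d → ℝ)) : ℝ :=
  ∑ s ∈ Finset.range T, if π.action 𝒜 s ω = b then ℓ (ω.2 s) else 0

lemma measurable_logRatio (π : Algorithm d m S) (𝒜 : ActionSet d m) (b : Finset (Fin d))
    {ℓ : (Fin d → ℝ) → ℝ} (hℓ : Measurable ℓ) (T : ℕ) : Measurable (logRatio π 𝒜 b ℓ T) :=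
  Finset.measurable_sum _ fun s _ => Measurable.ite (measurableSet_action_eq π 𝒜 s b)
    (hℓ.comp (by fun_prop)) measurable_const

/-- `ℓ` is the log-likelihood ratio of `p'` with respect to `p` through the observation of `b`,
and the other actions of `𝒜` do not distinguish `p` from `p'`. -/
def IsLogRatio (𝒜 : ActionSet d m) (p p' : Problem d m) (b : Finset (Fin d))
    (ℓ : (Fin d → ℝ) → ℝ) : Prop :=
  ∀ A ∈ 𝒜.actions, ∀ φ : Observation d → ENNReal, Measurable φ →
    ∫⁻ x, φ (observe A x) ∂p'.law =
      ∫⁻ x, φ (observe A x) * ENNReal.ofReal (Real.exp (if A = b then ℓ x else 0)) ∂p.law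

/-- Change of measure along the histories of an algorithm. -/
lemma lintegral_history_eq (π : Algorithm d m S) (𝒜 : ActionSet d m) (p p' : Problem d m)
    (b : Finset (Fin d)) {ℓ : (Fin d → ℝ) → ℝ} (hℓ : Measurable ℓ)
    (h : IsLogRatio 𝒜 p p' b ℓ) (T : ℕ) {f : S × (Fin T → Observation d) → ENNReal}
    (hf : Measurable f) :
    ∫⁻ ω, f (ω.1, π.history 𝒜 ω T) ∂jointLaw π p' =
      ∫⁻ ω, f (ω.1, π.history 𝒜 ω T) * ENNReal.ofReal (Real.exp (logRatio π 𝒜 b ℓ T ω))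
        ∂jointLaw π p := by
  induction T with
  | zero =>
    have key (p : Problem d m) : ∫⁻ ω, f (ω.1, Fin.elim0) ∂jointLaw π p =
        ∫⁻ s, f (s, Fin.elim0) ∂π.seedLaw := by
      have hm0 : Measurable fun ω : S × (ℕ → Fin d → ℝ) => f (ω.1, Fin.elim0) :=
        hf.comp (by fun_prop)
      rw [jointLaw, lintegral_prod _ hm0.aemeasurable]
      simp
    simp [logRatio, Algorithm.history, key]
  | succ T ih =>
    have hnext : Measurable fun q : (S × (Fin T → Observation d)) × (Fin d → ℝ) =>
        f (q.1.1, Fin.snoc (α := fun _ => Observation d) q.1.2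
          (observe (π.act 𝒜 T q.1) q.2)) :=
      hf.comp ((by fun_prop : Measurable fun q : (S × (Fin T → Observation d)) × (Fin d → ℝ) =>
        q.1.1).prodMk (measurable_snoc (by fun_prop) (measurable_observe
          ((π.measurable_act 𝒜 T).comp measurable_fst) measurable_snd)))
    have hhist (ω : S × (ℕ → Fin d → ℝ)) (x : Fin d → ℝ) :
        f ((resample T (ω, x)).1, π.history 𝒜 (resample T (ω, x)) (T + 1)) =
          f (ω.1, Fin.snoc (α := fun _ => Observation d) (π.history 𝒜 ω T)
            (observe (π.act 𝒜 T (ω.1, π.history 𝒜 ω T)) x)) := by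
      simp only [Algorithm.history, history_resample π 𝒜 T ω x le_rfl]
      simp [resample]
    have hlog (ω : S × (ℕ → Fin d → ℝ)) (x : Fin d → ℝ) :
        logRatio π 𝒜 b ℓ (T + 1) (resample T (ω, x)) =
          logRatio π 𝒜 b ℓ T ω + if π.act 𝒜 T (ω.1, π.history 𝒜 ω T) = b then ℓ x else 0 := by
      rw [logRatio, Finset.sum_range_succ, action_resample π 𝒜 T ω x le_rfl]
      congr 1
      · refine Finset.sum_congr rfl fun s hs => ?_
        have hs := Finset.mem_range.1 hs
        rw [action_resample π 𝒜 T ω x hs.le]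
        simp [resample, Function.update_of_ne hs.ne]
      · simp [resample, Algorithm.action]
    have hfm : Measurable fun ω : S × (ℕ → Fin d → ℝ) => f (ω.1, π.history 𝒜 ω (T + 1)) :=
      hf.comp (by fun_prop)
    have hem : Measurable fun ω : S × (ℕ → Fin d → ℝ) =>
        ENNReal.ofReal (Real.exp (logRatio π 𝒜 b ℓ (T + 1) ω)) :=
      ENNReal.measurable_ofReal.comp (Real.measurable_exp.comp (measurable_logRatio π 𝒜 b hℓ _))
    have hfem : Measurable fun ω : S × (ℕ → Fin d → ℝ) => f (ω.1, π.history 𝒜 ω (T + 1)) *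
        ENNReal.ofReal (Real.exp (logRatio π 𝒜 b ℓ (T + 1) ω)) := hfm.mul hem
    have hswap (p : Problem d m) {g : S × (ℕ → Fin d → ℝ) → ENNReal} (hg : Measurable g) :
        ∫⁻ ω, g ω ∂jointLaw π p = ∫⁻ ω, ∫⁻ x, g (resample T (ω, x)) ∂p.law ∂jointLaw π p := by
      rw [← (measurePreserving_resample π p T).lintegral_comp hg]
      exact lintegral_prod (fun q => g (resample T q))
        (hg.comp (measurePreserving_resample π p T).measurable).aemeasurable
    rw [hswap p' hfm, hswap p hfem]
    simp only [hhist, hlog]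
    -- With the last reward integrated out under `p'`, what remains is a function of the first `T`
    -- observations, to which the induction hypothesis applies; `h` then changes the law of the last
    -- reward.
    rw [ih (f := fun h => ∫⁻ x, f (h.1, Fin.snoc (α := fun _ => Observation d) h.2
      (observe (π.act 𝒜 T h) x)) ∂p'.law) hnext.lintegral_prod_right']
    refine lintegral_congr fun ω => ?_
    rw [h _ (π.act_mem 𝒜 T _) (fun o => f (ω.1, Fin.snoc (α := fun _ => Observation d)
      (π.history 𝒜 ω T) o)) (hf.comp (measurable_const.prodMk
        (measurable_snoc measurable_const measurable_id))),
      ← lintegral_mul_const' _ _ ENNReal.ofReal_ne_top]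
    refine lintegral_congr fun x => ?_
    rw [mul_assoc, Real.exp_add, ENNReal.ofReal_mul (Real.exp_pos _).le,
      mul_comm (ENNReal.ofReal (Real.exp (logRatio π 𝒜 b ℓ T ω)))]

/-- The number of times the action `b` is played during the first `T` stages. -/
noncomputable def pullCount (π : Algorithm d m S) (𝒜 : ActionSet d m) (b : Finset (Fin d)) (T : ℕ)
    (ω : S × (ℕ → Fin d → ℝ)) : ℝ :=
  ∑ s ∈ Finset.range T, if π.action 𝒜 s ω = b then 1 else 0

lemma measurable_pullCount (π : Algorithm d m S) (𝒜 : ActionSet d m) (b : Finset (Fin d)) (T : ℕ) :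
    Measurable (pullCount π 𝒜 b T) :=
  Finset.measurable_sum _ fun s _ => Measurable.ite (measurableSet_action_eq π 𝒜 s b)
    measurable_const measurable_const

lemma pullCount_nonneg (π : Algorithm d m S) (𝒜 : ActionSet d m) (b : Finset (Fin d)) (T : ℕ)
    (ω : S × (ℕ → Fin d → ℝ)) : 0 ≤ pullCount π 𝒜 b T ω :=
  Finset.sum_nonneg fun _ _ => by split_ifs <;> simp

lemma pullCount_le (π : Algorithm d m S) (𝒜 : ActionSet d m) (b : Finset (Fin d)) (T : ℕ)
    (ω : S × (ℕ → Fin d → ℝ)) : pullCount π 𝒜 b T ω ≤ T := by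
  refine (Finset.sum_le_sum (g := fun _ => (1 : ℝ)) fun s _ => ?_).trans_eq (by simp)
  split_ifs <;> simp

lemma integrable_pullCount (π : Algorithm d m S) (𝒜 : ActionSet d m) (b : Finset (Fin d)) (T : ℕ)
    (P : Measure (S × (ℕ → Fin d → ℝ))) [IsFiniteMeasure P] :
    Integrable (pullCount π 𝒜 b T) P :=
  Integrable.of_bound (measurable_pullCount π 𝒜 b T).aestronglyMeasurable T <| ae_of_all _ fun ω =>
    by rw [Real.norm_of_nonneg (pullCount_nonneg π 𝒜 b T ω)]; exact pullCount_le π 𝒜 b T ω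

lemma pullCount_eq_sum_history (π : Algorithm d m S) (𝒜 : ActionSet d m) (b : Finset (Fin d))
    (T : ℕ) (ω : S × (ℕ → Fin d → ℝ)) :
    pullCount π 𝒜 b T ω = ∑ s, if (π.history 𝒜 ω T s).1 = b then 1 else 0 := by
  simp only [history_fst]
  rw [pullCount, Finset.sum_range]

section LogRatio

variable (π : Algorithm d m S) (𝒜 : ActionSet d m) (p : Problem d m) (b : Finset (Fin d))
  {ℓ : (Fin d → ℝ) → ℝ}

/-- After resampling, the term splits into a function of the past times a function of the fresh
reward; integrability and Wald's identity follow from the product measure. -/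
lemma logRatio_term_resample (s : ℕ) (q : (S × (ℕ → Fin d → ℝ)) × (Fin d → ℝ)) :
    (if π.action 𝒜 s (resample s q) = b then ℓ ((resample s q).2 s) else 0) =
      (if π.action 𝒜 s q.1 = b then 1 else 0) * ℓ q.2 := by
  rw [show resample s q = resample s (q.1, q.2) from rfl, action_resample π 𝒜 s q.1 q.2 le_rfl]
  simp [resample]

lemma measurable_indicator_action (s : ℕ) :
    Measurable fun ω => if π.action 𝒜 s ω = b then (1 : ℝ) else 0 :=
  Measurable.ite (measurableSet_action_eq π 𝒜 s b) measurable_const measurable_const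

lemma integrable_indicator_action (s : ℕ) (P : Measure (S × (ℕ → Fin d → ℝ)))
    [IsFiniteMeasure P] : Integrable (fun ω => if π.action 𝒜 s ω = b then (1 : ℝ) else 0) P :=
  Integrable.of_bound (measurable_indicator_action π 𝒜 b s).aestronglyMeasurable 1 <|
    ae_of_all _ fun ω => by split_ifs <;> simp

lemma measurable_logRatio_term (hℓ : Measurable ℓ) (s : ℕ) :
    Measurable fun ω : S × (ℕ → Fin d → ℝ) => if π.action 𝒜 s ω = b then ℓ (ω.2 s) else 0 :=
  Measurable.ite (measurableSet_action_eq π 𝒜 s b) (hℓ.comp (by fun_prop)) measurable_const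

lemma integrable_logRatio_term (hℓ : Measurable ℓ) (hint : Integrable ℓ p.law) (s : ℕ) :
    Integrable (fun ω => if π.action 𝒜 s ω = b then ℓ (ω.2 s) else 0) (jointLaw π p) := by
  rw [← (measurePreserving_resample π p s).integrable_comp
    (measurable_logRatio_term π 𝒜 b hℓ s).aestronglyMeasurable]
  simp only [Function.comp_def, logRatio_term_resample]
  exact (integrable_indicator_action π 𝒜 b s _).mul_prod hint

lemma integral_logRatio_term (hℓ : Measurable ℓ) (s : ℕ) :
    ∫ ω, (if π.action 𝒜 s ω = b then ℓ (ω.2 s) else 0) ∂jointLaw π p =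
      (∫ ω, (if π.action 𝒜 s ω = b then 1 else 0) ∂jointLaw π p) * ∫ x, ℓ x ∂p.law := by
  have hmp := measurePreserving_resample π p s
  conv_lhs => rw [← hmp.map_eq]
  rw [integral_map hmp.aemeasurable (measurable_logRatio_term π 𝒜 b hℓ s).aestronglyMeasurable]
  simp only [logRatio_term_resample]
  exact integral_prod_mul (fun ω => if π.action 𝒜 s ω = b then (1 : ℝ) else 0) ℓ

lemma integrable_logRatio (hℓ : Measurable ℓ) (hint : Integrable ℓ p.law) (T : ℕ) :
    Integrable (logRatio π 𝒜 b ℓ T) (jointLaw π p) :=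
  integrable_finsetSum _ fun s _ => integrable_logRatio_term π 𝒜 p b hℓ hint s

/-- Wald's identity for the log-likelihood ratio. -/
lemma integral_logRatio (hℓ : Measurable ℓ) (hint : Integrable ℓ p.law) (T : ℕ) :
    ∫ ω, logRatio π 𝒜 b ℓ T ω ∂jointLaw π p =
      (∫ ω, pullCount π 𝒜 b T ω ∂jointLaw π p) * ∫ x, ℓ x ∂p.law := by
  simp only [logRatio, pullCount]
  rw [integral_finsetSum _ fun s _ => integrable_logRatio_term π 𝒜 p b hℓ hint s,
    integral_finsetSum _ fun s _ => integrable_indicator_action π 𝒜 b s _, Finset.sum_mul]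
  exact Finset.sum_congr rfl fun s _ => integral_logRatio_term π 𝒜 p b hℓ s

end LogRatio

/-- A Bretagnolle–Huber inequality: an event of the history that is unlikely under `p'` and whose
complement is unlikely under `p` requires many observations of the informative action. -/
lemma exp_neg_integral_pullCount_le (π : Algorithm d m S) (𝒜 : ActionSet d m) (p p' : Problem d m)
    (b : Finset (Fin d)) {ℓ : (Fin d → ℝ) → ℝ} (hℓ : Measurable ℓ) (hint : Integrable ℓ p.law)
    (h : IsLogRatio 𝒜 p p' b ℓ) (T : ℕ) {E : Set (S × (Fin T → Observation d))}
    (hE : MeasurableSet E) {q : ℝ} (hq : 0 < q)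
    (hp' : (jointLaw π p').real {ω | (ω.1, π.history 𝒜 ω T) ∈ E} ≤ q)
    (hp : (jointLaw π p).real {ω | (ω.1, π.history 𝒜 ω T) ∉ E} ≤ q) :
    Real.exp ((∫ ω, pullCount π 𝒜 b T ω ∂jointLaw π p) * (∫ x, ℓ x ∂p.law) / 2) ≤ 2 * √q := by
  set P := jointLaw π p
  set P' := jointLaw π p'
  set Λ := logRatio π 𝒜 b ℓ T
  have hΛm : Measurable Λ := measurable_logRatio π 𝒜 b hℓ T
  have hH : Measurable fun ω : S × (ℕ → Fin d → ℝ) => (ω.1, π.history 𝒜 ω T) := by fun_prop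
  -- Integrability of the likelihood ratio comes for free: its integral is a probability under `P'`.
  have hchange (F : Set (S × (Fin T → Observation d))) (hF : MeasurableSet F) :
      IntegrableOn (fun ω => Real.exp (Λ ω)) {ω | (ω.1, π.history 𝒜 ω T) ∈ F} P ∧
      ∫ ω in {ω | (ω.1, π.history 𝒜 ω T) ∈ F}, Real.exp (Λ ω) ∂P =
        P'.real {ω | (ω.1, π.history 𝒜 ω T) ∈ F} := by
    have hFm : MeasurableSet {ω : S × (ℕ → Fin d → ℝ) | (ω.1, π.history 𝒜 ω T) ∈ F} := hH hF
    have hl := lintegral_history_eq π 𝒜 p p' b hℓ h T (f := F.indicator 1)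
      (measurable_one.indicator hF)
    have hl' : P' {ω | (ω.1, π.history 𝒜 ω T) ∈ F} =
        ∫⁻ ω in {ω | (ω.1, π.history 𝒜 ω T) ∈ F}, ENNReal.ofReal (Real.exp (Λ ω)) ∂P := by
      rw [← lintegral_indicator_one hFm, ← lintegral_indicator hFm]
      refine Eq.trans ?_ (hl.trans ?_) <;> refine lintegral_congr fun ω => ?_ <;>
        by_cases hω : (ω.1, π.history 𝒜 ω T) ∈ F <;> simp [Set.indicator, hω, Λ]
    refine ⟨⟨(Real.measurable_exp.comp hΛm).aestronglyMeasurable, ?_⟩, ?_⟩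
    · rw [hasFiniteIntegral_iff_ofReal (ae_of_all _ fun _ => (Real.exp_pos _).le), ← hl']
      exact measure_lt_top _ _
    · rw [integral_eq_lintegral_of_nonneg_ae (ae_of_all _ fun _ => (Real.exp_pos _).le)
        (Real.measurable_exp.comp hΛm).aestronglyMeasurable, ← hl', measureReal_def]
  have hEm : MeasurableSet {ω : S × (ℕ → Fin d → ℝ) | (ω.1, π.history 𝒜 ω T) ∈ E} := hH hE
  set F := {ω : S × (ℕ → Fin d → ℝ) | (ω.1, π.history 𝒜 ω T) ∈ E}
  have hcF : {ω : S × (ℕ → Fin d → ℝ) | (ω.1, π.history 𝒜 ω T) ∉ E} = Fᶜ := rfl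
  obtain ⟨hi1, he1⟩ := hchange E hE
  obtain ⟨hi2, he2⟩ := hchange Eᶜ hE.compl
  change IntegrableOn _ Fᶜ P at hi2
  change ∫ ω in Fᶜ, _ ∂P = P'.real Fᶜ at he2
  rw [hcF] at hp
  set r := √q
  have hr : 0 < r := Real.sqrt_pos.2 hq
  have hrq : q = r * r := (Real.mul_self_sqrt hq.le).symm
  have hΛi : Integrable Λ P := integrable_logRatio π 𝒜 p b hℓ hint T
  have hexp : Integrable (fun ω => Real.exp (Λ ω)) P := by
    rw [← integrableOn_univ, ← Set.union_compl_self F]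
    exact hi1.union hi2
  -- A weighted AM–GM inequality, used instead of Cauchy–Schwarz to bound the integral of the square
  -- root of the likelihood ratio on each event.
  have hamgm (c x : ℝ) (hc : 0 < c) : Real.exp (x / 2) ≤ (c + Real.exp x / c) / 2 := by
    have hx : Real.exp x = Real.exp (x / 2) * Real.exp (x / 2) := by
      rw [← Real.exp_add]; ring_nf
    rw [hx]
    have : (c + Real.exp (x / 2) * Real.exp (x / 2) / c) / 2 - Real.exp (x / 2) =
        (Real.exp (x / 2) - c) ^ 2 / (2 * c) := by field_simp; ring
    have h0 : 0 ≤ (Real.exp (x / 2) - c) ^ 2 / (2 * c) := by positivity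
    linarith
  have hhalf : Integrable (fun ω => Real.exp (Λ ω / 2)) P := by
    refine ((integrable_const (1 : ℝ)).add hexp).mono'
      (Real.measurable_exp.comp (hΛm.div_const 2)).aestronglyMeasurable (ae_of_all _ fun ω => ?_)
    have := hamgm 1 (Λ ω) one_pos
    have := Real.exp_pos (Λ ω)
    simp only [Real.norm_eq_abs, Real.abs_exp, Pi.add_apply]
    linarith
  have hbound (G : Set (S × (ℕ → Fin d → ℝ))) (hiG : IntegrableOn (fun ω => Real.exp (Λ ω)) G P)
      (heG : ∫ ω in G, Real.exp (Λ ω) ∂P = P'.real G) (c : ℝ) (hc : 0 < c) :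
      ∫ ω in G, Real.exp (Λ ω / 2) ∂P ≤ (c * P.real G + P'.real G / c) / 2 := by
    refine (setIntegral_mono (g := fun ω => (c + Real.exp (Λ ω) / c) / 2) hhalf.integrableOn
      (((integrable_const c).add (hiG.div_const c)).div_const 2)
      fun ω => hamgm c (Λ ω) hc).trans_eq ?_
    rw [integral_div, integral_add (integrable_const c) (hiG.div_const c), integral_div, heG]
    simp [mul_comm]
  have hupper : ∫ ω, Real.exp (Λ ω / 2) ∂P ≤ 2 * r := by
    rw [← integral_add_compl hEm hhalf]
    -- The weights `r = √q` on `F` and `r⁻¹` on its complement balance the two terms, so that each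
    -- event contributes at most `r`.
    have h1 := hbound F hi1 he1 r hr
    have h2 := hbound Fᶜ hi2 he2 r⁻¹ (inv_pos.2 hr)
    have hF1 : P.real F ≤ 1 := measureReal_le_one
    have hF2 : P'.real Fᶜ ≤ 1 := measureReal_le_one
    have e1 : r * P.real F ≤ r := mul_le_of_le_one_right hr.le hF1
    have e2 : P'.real F / r ≤ r := by rw [div_le_iff₀ hr, ← hrq]; exact hp'
    have e3 : r⁻¹ * P.real Fᶜ ≤ r := by rw [inv_mul_le_iff₀ hr, ← hrq]; exact hp
    have e4 : P'.real Fᶜ / r⁻¹ ≤ r := by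
      rw [div_inv_eq_mul]; exact mul_le_of_le_one_left hr.le hF2
    linarith
  refine le_trans ?_ hupper
  rw [← integral_logRatio π 𝒜 p b hℓ hint T]
  change Real.exp ((∫ ω, Λ ω ∂P) / 2) ≤ _
  set c := ∫ ω, Λ ω ∂P
  -- Jensen's inequality through the tangent line of the exponential at the mean of `Λ / 2`.
  have hlow : ∫ ω, Real.exp (c / 2) * (1 + (Λ ω - c) / 2) ∂P ≤ ∫ ω, Real.exp (Λ ω / 2) ∂P := by
    refine integral_mono (((integrable_const _).add
      ((hΛi.sub (integrable_const c)).div_const 2)).const_mul _) hhalf fun ω => ?_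
    have : Real.exp (Λ ω / 2) = Real.exp (c / 2) * Real.exp ((Λ ω - c) / 2) := by
      rw [← Real.exp_add]; ring_nf
    simp only [this]
    gcongr
    linarith [Real.add_one_le_exp ((Λ ω - c) / 2)]
  refine le_trans (le_of_eq ?_) hlow
  have hcent : Integrable (fun ω => (Λ ω - c) / 2) P :=
    (hΛi.sub (integrable_const c)).div_const 2
  rw [integral_const_mul, integral_add (integrable_const _) hcent, integral_div,
    integral_sub hΛi (integrable_const c)]
  simp [c]

end SemiBandit

/-! ### From regret to numbers of plays. -/

namespace SemiBandit

section Regret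

variable {d m : ℕ} {S : Type*} [MeasurableSpace S]

lemma Problem.gap_nonneg (p : Problem d m) {A : Finset (Fin d)} (hA : A ∈ p.actionSet.actions) :
    0 ≤ p.gap A :=
  sub_nonneg.2 (Finset.le_sup' p.value hA)

lemma integrable_regret (π : Algorithm d m S) (p : Problem d m) (T : ℕ) :
    Integrable (fun ω => ∑ t ∈ Finset.range T, p.gap (π.action p.actionSet t ω))
      (jointLaw π p) :=
  integrable_finsetSum _ fun t _ =>
    (Integrable.of_finite (f := p.gap)
      (μ := (jointLaw π p).map (π.action p.actionSet t))).comp_measurable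
      (measurable_action π p.actionSet t)

lemma mul_integral_pullCount_le_expectedRegret (π : Algorithm d m S) (p : Problem d m)
    {b : Finset (Fin d)} {δ : ℝ} (hb : δ ≤ p.gap b) (T : ℕ) :
    δ * ∫ ω, pullCount π p.actionSet b T ω ∂jointLaw π p ≤ expectedRegret π p T := by
  rw [← integral_const_mul]
  refine integral_mono ((integrable_pullCount π _ b T _).const_mul δ)
    (integrable_regret π p T) fun ω => ?_
  simp only [pullCount, Finset.mul_sum]
  refine Finset.sum_le_sum fun t _ => ?_
  split_ifs with h
  · simpa [h] using hb
  · rw [mul_zero]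
    exact p.gap_nonneg (π.act_mem _ _ _)

lemma mul_integral_sub_pullCount_le_expectedRegret (π : Algorithm d m S) (p : Problem d m)
    {b : Finset (Fin d)} {δ : ℝ} (hb : ∀ A ∈ p.actionSet.actions, A ≠ b → δ ≤ p.gap A) (T : ℕ) :
    δ * ∫ ω, (T - pullCount π p.actionSet b T ω) ∂jointLaw π p ≤ expectedRegret π p T := by
  rw [← integral_const_mul]
  refine integral_mono
    (((integrable_const _).sub (integrable_pullCount π _ b T _)).const_mul δ)
    (integrable_regret π p T) fun ω => ?_
  have hT : (T : ℝ) = ∑ _t ∈ Finset.range T, (1 : ℝ) := by simp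
  simp only [pullCount]
  rw [hT, ← Finset.sum_sub_distrib, Finset.mul_sum]
  refine Finset.sum_le_sum fun t _ => ?_
  have hmem : π.action p.actionSet t ω ∈ p.actionSet.actions := π.act_mem _ _ _
  split_ifs with h
  · simpa using p.gap_nonneg hmem
  · simpa using hb _ hmem h

lemma sum_mul_integral_pullCount_le_expectedRegret {ι : Type*} (π : Algorithm d m S)
    (p : Problem d m) (s : Finset ι) {B : ι → Finset (Fin d)} (hB : Function.Injective B) {δ : ℝ}
    (hgap : ∀ i ∈ s, δ ≤ p.gap (B i)) (T : ℕ) :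
    ∑ i ∈ s, δ * ∫ ω, pullCount π p.actionSet (B i) T ω ∂jointLaw π p ≤
      expectedRegret π p T := by
  classical
  simp_rw [← integral_const_mul]
  rw [← integral_finsetSum _ fun i _ => (integrable_pullCount π _ (B i) T _).const_mul δ]
  refine integral_mono (integrable_finsetSum _ fun i _ =>
    (integrable_pullCount π _ (B i) T _).const_mul δ) (integrable_regret π p T) fun ω => ?_
  simp only [pullCount, Finset.mul_sum]
  rw [Finset.sum_comm]
  refine Finset.sum_le_sum fun t _ => ?_
  -- Since `B` is injective, at most one term of the sum is nonzero at each stage.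
  by_cases h : ∃ i ∈ s, π.action p.actionSet t ω = B i
  · obtain ⟨i, hi, hA⟩ := h
    rw [Finset.sum_eq_single i]
    · simpa [hA] using hgap i hi
    · intro j _ hji
      rw [if_neg, mul_zero]
      exact fun h => hji (hB (h.symm.trans hA))
    · exact fun h => absurd hi h
  · rw [Finset.sum_eq_zero]
    · exact p.gap_nonneg (π.act_mem _ _ _)
    · intro i hi
      rw [if_neg (fun hA => h ⟨i, hi, hA⟩), mul_zero]

/-- If both `p` and `p'` have subpolynomial regret, and `b` is suboptimal for `p` but optimal for
`p'`, then `b` is played logarithmically often on `p`. -/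
lemma eventually_log_le_integral_pullCount (π : Algorithm d m S) (p p' : Problem d m)
    (hact : p'.actionSet = p.actionSet) (b : Finset (Fin d)) {ℓ : (Fin d → ℝ) → ℝ}
    (hℓ : Measurable ℓ) (hint : Integrable ℓ p.law) (h : IsLogRatio p.actionSet p p' b ℓ)
    {δ a : ℝ} (hδ : 0 < δ) (ha : 0 < a) (hgap : δ ≤ p.gap b)
    (hgap' : ∀ A ∈ p'.actionSet.actions, A ≠ b → δ ≤ p'.gap A)
    (hreg : (fun t : ℕ => expectedRegret π p t) =o[atTop] (fun t : ℕ => (t : ℝ) ^ a))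
    (hreg' : (fun t : ℕ => expectedRegret π p' t) =o[atTop] (fun t : ℕ => (t : ℝ) ^ a)) :
    ∀ᶠ T : ℕ in atTop, (1 - 2 * a) * Real.log T ≤
      (∫ ω, pullCount π p.actionSet b T ω ∂jointLaw π p) * -∫ x, ℓ x ∂p.law := by
  have hlog : Tendsto (fun T : ℕ => a * Real.log T) atTop atTop :=
    (Real.tendsto_log_atTop.comp tendsto_natCast_atTop_atTop).const_mul_atTop ha
  -- The factor `δ / 2` cancels against the threshold `T / 2` in Markov's inequality, leaving the
  -- bound `q = T ^ a / T`. The third condition absorbs the `2 * log 2` due to the factor `2` in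
  -- Bretagnolle–Huber, turning `1 - a` into `1 - 2 * a`.
  filter_upwards [hreg.def (half_pos hδ), hreg'.def (half_pos hδ),
    hlog.eventually_ge_atTop (2 * Real.log 2), eventually_gt_atTop 0] with T h1 h2 h3 hT0
  have hT : (0 : ℝ) < T := by exact_mod_cast hT0
  have hTa : (0 : ℝ) < (T : ℝ) ^ a := Real.rpow_pos_of_pos hT a
  set q : ℝ := (T : ℝ) ^ a / T with hq
  have hqpos : 0 < q := div_pos hTa hT
  rw [Real.norm_of_nonneg hTa.le] at h1 h2
  have h1 := (le_abs_self _).trans h1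
  have h2 := (le_abs_self _).trans h2
  -- The event that `b` is played less than half of the time: unlikely under `p'`, where `b` is
  -- optimal, while its complement is unlikely under `p`.
  let E : Set (S × (Fin T → Observation d)) :=
    {h | ∑ s, (if (h.2 s).1 = b then (1 : ℝ) else 0) < T / 2}
  have hE : MeasurableSet E := by
    refine measurableSet_lt (Finset.measurable_sum _ fun s _ => Measurable.ite ?_
      measurable_const measurable_const) measurable_const
    exact (by fun_prop : Measurable fun h : S × (Fin T → Observation d) => (h.2 s).1)
      (measurableSet_singleton b)
  have hEiff (ω : S × (ℕ → Fin d → ℝ)) : (ω.1, π.history p.actionSet ω T) ∈ E ↔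
      pullCount π p.actionSet b T ω < T / 2 := by
    rw [pullCount_eq_sum_history]; rfl
  have hp' : (jointLaw π p').real {ω | (ω.1, π.history p.actionSet ω T) ∈ E} ≤ q := by
    have hm := mul_meas_ge_le_integral_of_nonneg (μ := jointLaw π p')
      (f := fun ω => T - pullCount π p.actionSet b T ω)
      (ae_of_all _ fun ω => sub_nonneg.2 (pullCount_le π _ b T ω))
      ((integrable_const _).sub (integrable_pullCount π _ b T _)) (T / 2)
    have hr := mul_integral_sub_pullCount_le_expectedRegret π p' hgap' T
    rw [hact] at hr
    have hsub : (jointLaw π p').real {ω | (ω.1, π.history p.actionSet ω T) ∈ E} ≤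
        (jointLaw π p').real {ω | T / 2 ≤ T - pullCount π p.actionSet b T ω} := by
      refine measureReal_mono fun ω hω => ?_
      have := (hEiff ω).1 hω
      simp only [Set.mem_ofPred_eq]
      linarith
    refine hsub.trans ?_
    rw [hq, le_div_iff₀ hT]
    have := mul_le_mul_of_nonneg_left hm hδ.le
    refine le_of_mul_le_mul_left ?_ (half_pos hδ)
    linarith
  have hp : (jointLaw π p).real {ω | (ω.1, π.history p.actionSet ω T) ∉ E} ≤ q := by
    have hm := mul_meas_ge_le_integral_of_nonneg (μ := jointLaw π p)
      (f := pullCount π p.actionSet b T)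
      (ae_of_all _ fun ω => pullCount_nonneg π _ b T ω) (integrable_pullCount π _ b T _) (T / 2)
    have hr := mul_integral_pullCount_le_expectedRegret π p hgap T
    have hset : {ω | (ω.1, π.history p.actionSet ω T) ∉ E} =
        {ω | T / 2 ≤ pullCount π p.actionSet b T ω} := by
      ext ω
      simp only [Set.mem_ofPred_eq, hEiff, not_lt]
    rw [hset, hq, le_div_iff₀ hT]
    have := mul_le_mul_of_nonneg_left hm hδ.le
    refine le_of_mul_le_mul_left ?_ (half_pos hδ)
    linarith
  have key := exp_neg_integral_pullCount_le π p.actionSet p p' b hℓ hint h T hE hqpos hp' hp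
  have hkey := Real.log_le_log (Real.exp_pos _) key
  rw [Real.log_exp, Real.log_mul two_ne_zero (Real.sqrt_pos.2 hqpos).ne', Real.log_sqrt hqpos.le,
    hq, Real.log_div hTa.ne' hT.ne', Real.log_rpow hT] at hkey
  linarith

end Regret

/-! ### The Gaussian problem with disjoint correlated blocks. -/

section Blocks

variable {m k : ℕ}

/-- The index of the block of `m` arms to which an arm belongs. -/
def blockOf (i : Fin (m * k)) : Fin k := (finProdFinEquiv.symm i).2

/-- The arms of a block. -/
def block (m : ℕ) {k : ℕ} (b : Fin k) : Finset (Fin (m * k)) :=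
  Finset.univ.filter fun i => blockOf i = b

@[simp]
lemma mem_block {b : Fin k} {i : Fin (m * k)} : i ∈ block m b ↔ blockOf i = b := by
  simp [block]

lemma card_block (b : Fin k) : (block m b).card = m := by
  have : block m b = Finset.univ.map
      ⟨fun r : Fin m => finProdFinEquiv (r, b), fun r s h => by simpa using h⟩ := by
    ext i
    simp only [mem_block, blockOf, Finset.mem_map, Finset.mem_univ, true_and]
    constructor
    · rintro rfl
      exact ⟨(finProdFinEquiv.symm i).1, finProdFinEquiv.apply_symm_apply i⟩
    · rintro ⟨r, rfl⟩
      exact congrArg Prod.snd (finProdFinEquiv.symm_apply_apply (r, b))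
  rw [this, Finset.card_map, Finset.card_univ, Fintype.card_fin]

lemma block_injective (hm : 1 ≤ m) : Function.Injective (block m : Fin k → _) := by
  intro b c h
  have : (block m b).Nonempty := Finset.card_pos.1 (by rw [card_block]; exact hm)
  obtain ⟨i, hi⟩ := this
  exact (mem_block.1 hi).symm.trans (mem_block.1 (h ▸ hi))

/-- The action set made of `k` disjoint blocks of `m` arms. -/
def blockActions (m k : ℕ) [NeZero k] : ActionSet (m * k) m where
  actions := Finset.univ.image (block m)
  nonempty := ⟨block m 0, by simp⟩
  card_eq A hA := by
    obtain ⟨b, _, rfl⟩ := Finset.mem_image.1 hA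
    exact card_block b

/-- A matrix factorizing the covariance matrix of disjoint blocks with variances `σ ^ 2` and
correlation coefficients `γ` inside each block. -/
noncomputable def blockFactor (m k : ℕ) (σ γ : ℝ) :
    Matrix (Fin (m * k)) (Fin k ⊕ Fin (m * k)) ℝ :=
  -- The noise of an arm is the sum of a factor shared by its block and of an independent factor of
  -- its own.
  Matrix.of fun i => Sum.elim (fun b => if blockOf i = b then σ * √γ else 0)
    (fun j => if i = j then σ * √(1 - γ) else 0)

lemma blockFactor_mul_transpose_apply {σ γ : ℝ} (hγ0 : 0 ≤ γ) (hγ1 : γ ≤ 1) (i j : Fin (m * k)) :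
    (blockFactor m k σ γ * (blockFactor m k σ γ)ᵀ) i j =
      (if blockOf i = blockOf j then σ ^ 2 * γ else 0) +
        if i = j then σ ^ 2 * (1 - γ) else 0 := by
  have h1 : σ * √γ * (σ * √γ) = σ ^ 2 * γ := by
    rw [mul_mul_mul_comm, Real.mul_self_sqrt hγ0, sq]
  have h2 : σ * √(1 - γ) * (σ * √(1 - γ)) = σ ^ 2 * (1 - γ) := by
    rw [mul_mul_mul_comm, Real.mul_self_sqrt (sub_nonneg.2 hγ1), sq]
  simp [blockFactor, Matrix.mul_apply, Fintype.sum_sum_type, h1, h2, eq_comm]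

/-- The vector equal to `c` on a block and to `0` elsewhere. -/
def blockVec (m : ℕ) {k : ℕ} (b : Fin k) (c : ℝ) : Fin (m * k) → ℝ :=
  fun i => if blockOf i = b then c else 0

lemma blockVec_dotProduct_blockVec (b : Fin k) (c c' : ℝ) :
    blockVec m b c ⬝ᵥ blockVec m b c' = m * (c * c') := by
  simp only [dotProduct, blockVec, ite_mul, zero_mul, mul_ite, mul_zero, ← ite_and, and_self]
  rw [← Finset.sum_filter]
  change ∑ i ∈ block m b, _ = _
  simp [card_block]

/-- A row of the covariance sums to `m * σ ^ 2 * γ + σ ^ 2 * (1 - γ)` over its own block and to `0`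
over any other. This eigenvalue is the source of the factor `1 + γ * (m - 1)` in the bound. -/
lemma blockFactor_mul_transpose_mulVec_blockVec {σ γ : ℝ} (hγ0 : 0 ≤ γ) (hγ1 : γ ≤ 1)
    (b : Fin k) (c : ℝ) :
    (blockFactor m k σ γ * (blockFactor m k σ γ)ᵀ) *ᵥ blockVec m b c =
      blockVec m b (σ ^ 2 * (1 + γ * (m - 1)) * c) := by
  ext i
  simp only [mulVec, dotProduct, blockFactor_mul_transpose_apply hγ0 hγ1, add_mul,
    Finset.sum_add_distrib]
  have h2 : ∑ j, (if i = j then σ ^ 2 * (1 - γ) else 0) * blockVec m b c j =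
      σ ^ 2 * (1 - γ) * blockVec m b c i := by simp
  have h1 : ∑ j, (if blockOf i = blockOf j then σ ^ 2 * γ else 0) * blockVec m b c j =
      if blockOf i = b then m * (σ ^ 2 * γ * c) else 0 := by
    split_ifs with hi
    · rw [← blockVec_dotProduct_blockVec b (σ ^ 2 * γ) c]
      simp [dotProduct, blockVec, hi, eq_comm]
    · refine Finset.sum_eq_zero fun j _ => ?_
      simp only [blockVec]
      split_ifs with h h' <;> simp_all
  rw [h1, h2]
  simp only [blockVec]
  split_ifs <;> ring

/-- Gaussian rewards on `k` disjoint blocks of `m` arms, with mean `ν b` for the arms of the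
block `b`. -/
noncomputable def blockProblem (m k : ℕ) [NeZero k] (σ γ : ℝ) (ν : Fin k → ℝ) :
    Problem (m * k) m where
  actionSet := blockActions m k
  law := gaussianLaw (blockFactor m k σ γ) fun i => ν (blockOf i)
  isProb := inferInstance

variable (σ γ : ℝ) (ν : Fin k → ℝ)

/-- The log-likelihood ratio between block problems whose means differ on one block. -/
noncomputable def blockLogRatio (b : Fin k) (c : ℝ) (x : Fin (m * k) → ℝ) : ℝ :=
  blockVec m b c ⬝ᵥ (x - fun i => ν (blockOf i)) -
    m * (σ ^ 2 * (1 + γ * (m - 1)) * c ^ 2) / 2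

lemma measurable_blockLogRatio (b : Fin k) (c : ℝ) :
    Measurable (blockLogRatio (m := m) σ γ ν b c) :=
  Continuous.measurable (by unfold blockLogRatio; fun_prop)

variable [NeZero k]

lemma blockProblem_mean : (blockProblem m k σ γ ν).mean = fun i => ν (blockOf i) :=
  funext fun i => integral_eval_gaussianLaw _ _ i

lemma blockProblem_value (b : Fin k) : (blockProblem m k σ γ ν).value (block m b) = m * ν b := by
  rw [Problem.value, blockProblem_mean,
    Finset.sum_congr rfl fun i hi => congrArg ν (mem_block.1 hi)]
  simp [card_block]

lemma blockProblem_gap {c : Fin k} (hc : ∀ b, ν b ≤ ν c) (b : Fin k) :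
    (blockProblem m k σ γ ν).gap (block m b) = m * (ν c - ν b) := by
  have hsup : (blockProblem m k σ γ ν).actionSet.actions.sup'
      (blockProblem m k σ γ ν).actionSet.nonempty (blockProblem m k σ γ ν).value = m * ν c := by
    refine le_antisymm (Finset.sup'_le _ _ fun A hA => ?_) ?_
    · obtain ⟨b, _, rfl⟩ := Finset.mem_image.1 hA
      rw [blockProblem_value]
      exact mul_le_mul_of_nonneg_left (hc b) (Nat.cast_nonneg m)
    · rw [← blockProblem_value σ γ ν c]
      exact Finset.le_sup' _ (Finset.mem_image_of_mem _ (Finset.mem_univ c))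
  rw [Problem.gap, hsup, blockProblem_value]
  ring

lemma blockProblem_isSubgaussianWith {σ γ : ℝ} (hσ : 0 < σ) (hγ0 : 0 ≤ γ) (hγ1 : γ ≤ 1) :
    (blockProblem m k σ γ ν).IsSubgaussianWith σ γ := by
  have hdiag (i : Fin (m * k)) :
      (blockFactor m k σ γ * (blockFactor m k σ γ)ᵀ) i i = σ ^ 2 := by
    rw [blockFactor_mul_transpose_apply hγ0 hγ1]
    simp
    ring
  refine ⟨blockFactor m k σ γ * (blockFactor m k σ γ)ᵀ, ⟨?_, fun u => ?_⟩, fun i => (hdiag i).le,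
    fun i j hij => ?_⟩
  · simpa using posSemidef_self_mul_conjTranspose (blockFactor m k σ γ)
  · rw [blockProblem_mean]
    exact ⟨integrable_exp_gaussianLaw _ _ u, (integral_exp_gaussianLaw _ _ u).le⟩
  · rw [hdiag, hdiag, Real.sqrt_mul_self (by positivity),
      blockFactor_mul_transpose_apply hγ0 hγ1, if_neg hij, add_zero,
      div_le_iff₀ (by positivity), mul_comm γ]
    split_ifs
    · rfl
    · positivity

lemma integrable_blockVec_mul_sub (b : Fin k) (c : ℝ) (i : Fin (m * k)) :
    Integrable (fun x : Fin (m * k) → ℝ => blockVec m b c i * (x i - ν (blockOf i)))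
      (blockProblem m k σ γ ν).law :=
  ((integrable_eval_gaussianLaw _ _ i).sub (integrable_const _)).const_mul _

lemma integrable_blockLogRatio (b : Fin k) (c : ℝ) :
    Integrable (blockLogRatio σ γ ν b c) (blockProblem m k σ γ ν).law :=
  (integrable_finsetSum _ fun i _ => integrable_blockVec_mul_sub σ γ ν b c i).sub
    (integrable_const _)

/-- Only the constant survives, as the linear part is centred; it is minus the Kullback–Leibler
divergence carried by one play of the block. -/
lemma integral_blockLogRatio (b : Fin k) (c : ℝ) :
    ∫ x, blockLogRatio σ γ ν b c x ∂(blockProblem m k σ γ ν).law =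
      -(m * (σ ^ 2 * (1 + γ * (m - 1)) * c ^ 2) / 2) := by
  simp only [blockLogRatio, dotProduct, Pi.sub_apply]
  rw [integral_sub (integrable_finsetSum _ fun i _ => integrable_blockVec_mul_sub σ γ ν b c i)
    (integrable_const _), integral_finsetSum _ fun i _ => integrable_blockVec_mul_sub σ γ ν b c i]
  have hzero (i : Fin (m * k)) : ∫ x : Fin (m * k) → ℝ, blockVec m b c i * (x i - ν (blockOf i))
      ∂(blockProblem m k σ γ ν).law = 0 := by
    have hi : Integrable (fun x : Fin (m * k) → ℝ => x i) (blockProblem m k σ γ ν).law :=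
      integrable_eval_gaussianLaw _ _ i
    have he : ∫ x, x i ∂(blockProblem m k σ γ ν).law = ν (blockOf i) :=
      integral_eval_gaussianLaw _ _ i
    rw [integral_const_mul, integral_sub hi (integrable_const _), he]
    simp
  simp [hzero]

lemma isLogRatio_blockProblem {σ γ : ℝ} (hγ0 : 0 ≤ γ) (hγ1 : γ ≤ 1) (b : Fin k) (c : ℝ) :
    IsLogRatio (blockActions m k) (blockProblem m k σ γ ν)
      (blockProblem m k σ γ
        (Function.update ν b (ν b + σ ^ 2 * (1 + γ * (m - 1)) * c)))
      (block m b) (blockLogRatio σ γ ν b c) := by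
  set L := blockFactor m k σ γ with hL
  have hmean : (fun i : Fin (m * k) =>
      Function.update ν b (ν b + σ ^ 2 * (1 + γ * (m - 1)) * c) (blockOf i)) =
        (fun i => ν (blockOf i)) + blockVec m b (σ ^ 2 * (1 + γ * (m - 1)) * c) := by
    ext i
    by_cases hi : blockOf i = b <;> simp [blockVec, hi]
  have hlaw : (blockProblem m k σ γ
      (Function.update ν b (ν b + σ ^ 2 * (1 + γ * (m - 1)) * c))).law =
        gaussianLaw L ((fun i => ν (blockOf i)) +
          blockVec m b (σ ^ 2 * (1 + γ * (m - 1)) * c)) := by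
    rw [← hmean]; rfl
  intro A hA φ hφ
  have hφA : Measurable fun x => φ (observe A x) :=
    hφ.comp (measurable_observe measurable_const measurable_id)
  rw [hlaw]
  by_cases hAb : A = block m b
  -- The mean shift is the covariance applied to `blockVec m b c`, so Cameron–Martin gives the
  -- density.
  · rw [← blockFactor_mul_transpose_mulVec_blockVec hγ0 hγ1, gaussianLaw_add_eq_withDensity,
      blockFactor_mul_transpose_mulVec_blockVec hγ0 hγ1, blockVec_dotProduct_blockVec,
      lintegral_withDensity_eq_lintegral_mul _ (by fun_prop) hφA]
    refine lintegral_congr fun x => ?_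
    rw [Pi.mul_apply, mul_comm, if_pos hAb, blockLogRatio]
    ring_nf
  -- Any other block is disjoint from `b`, so translating the rewards along `b` leaves its feedback
  -- unchanged.
  · rw [← gaussianLaw_map_add, lintegral_map hφA (by fun_prop)]
    simp only [if_neg hAb, Real.exp_zero, ENNReal.ofReal_one, mul_one]
    refine lintegral_congr fun x => ?_
    obtain ⟨a, _, rfl⟩ := Finset.mem_image.1 hA
    have hab : a ≠ b := fun h => hAb (h ▸ rfl)
    congr 1
    simp only [observe, Prod.mk.injEq, true_and]
    ext i
    by_cases hi : blockOf i = a <;> simp [hi, blockVec, hab]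

end Blocks

end SemiBandit

/-! ### The lower bound for consistent algorithms. -/

namespace SemiBandit

variable {S : Type*} [MeasurableSpace S] {m k : ℕ} [NeZero k]

/-- On the block problem where the block `0` beats all the others by `Δ`, every other block is
played logarithmically often by a consistent algorithm. -/
lemma eventually_log_le_integral_pullCount_block (hm : 1 ≤ m) {σ γ Δ : ℝ} (hσ : 0 < σ)
    (hγ0 : 0 ≤ γ) (hγ1 : γ ≤ 1) (hΔ : 0 < Δ) (π : Algorithm (m * k) m S)
    (hπ : π.IsConsistent σ γ) {b : Fin k} (hb : b ≠ 0) {a : ℝ} (ha : 0 < a) (ha1 : a < 1) :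
    ∀ᶠ T : ℕ in atTop, (1 - 2 * a) * Real.log T ≤
      (∫ ω, pullCount π (blockActions m k) (block m b) T ω
        ∂jointLaw π (blockProblem m k σ γ fun c => if c = 0 then 0 else -Δ / m)) *
        (Δ ^ 2 * (1 + a) ^ 2 / (2 * m * σ ^ 2 * (1 + γ * (m - 1)))) := by
  have hm1 : (1 : ℝ) ≤ m := by exact_mod_cast hm
  have hmpos : (0 : ℝ) < m := by linarith
  have hκ : (0 : ℝ) < 1 + γ * (m - 1) := by
    have := mul_nonneg hγ0 (sub_nonneg.2 hm1)
    linarith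
  set ν : Fin k → ℝ := fun c => if c = 0 then 0 else -Δ / m with hν
  have hνle (c : Fin k) : ν c ≤ 0 := by
    simp only [hν]
    split_ifs
    · rfl
    · rw [neg_div, neg_nonpos]; positivity
  -- Chosen so that the means of `b` rise by `(1 + a) * Δ / m`, from `-Δ / m` to `a * Δ / m`.
  set c : ℝ := Δ * (1 + a) / (m * (σ ^ 2 * (1 + γ * (m - 1)))) with hc
  have hshift : ν b + σ ^ 2 * (1 + γ * (m - 1)) * c = a * Δ / m := by
    simp only [hν, if_neg hb, hc]
    field_simp
    ring
  have hlog := isLogRatio_blockProblem (m := m) ν (σ := σ) hγ0 hγ1 b c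
  rw [hshift] at hlog
  have hpos : 0 < a * Δ / m := by positivity
  have hmax (c : Fin k) : Function.update ν b (a * Δ / m) c ≤
      Function.update ν b (a * Δ / m) b := by
    by_cases hcb : c = b
    · rw [hcb]
    · simpa [hcb] using (hνle c).trans hpos.le
  -- The common gap `δ = a * Δ` serves both problems: it is at most `Δ` because `a < 1`, and it is
  -- the lead of `b` over block `0` in the alternative. The same `a` serves as the exponent in the
  -- consistency assumption.
  have key := eventually_log_le_integral_pullCount π (blockProblem m k σ γ ν)
    (blockProblem m k σ γ (Function.update ν b (a * Δ / m))) rfl (block m b)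
    (measurable_blockLogRatio σ γ ν b c) (integrable_blockLogRatio σ γ ν b c) hlog
    (mul_pos ha hΔ) ha ?_ ?_ (hπ _ (blockProblem_isSubgaussianWith ν hσ hγ0 hγ1) a ha)
    (hπ _ (blockProblem_isSubgaussianWith _ hσ hγ0 hγ1) a ha)
  · filter_upwards [key] with T hT
    refine hT.trans_eq ?_
    rw [integral_blockLogRatio, neg_neg]
    congr 1
    rw [hc]
    field_simp
  · rw [blockProblem_gap σ γ ν (c := 0) (by simpa [hν] using hνle) b]
    have : (m : ℝ) * (ν 0 - ν b) = Δ := by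
      simp only [hν, if_neg hb, if_pos]
      field_simp
      ring
    rw [this]
    nlinarith
  · intro A hA hAb
    obtain ⟨e, _, rfl⟩ := Finset.mem_image.1 hA
    have heb : e ≠ b := fun h => hAb (h ▸ rfl)
    rw [blockProblem_gap σ γ _ hmax e, Function.update_self, Function.update_of_ne heb, mul_sub,
      mul_div_cancel₀ _ hmpos.ne']
    have := mul_nonpos_of_nonneg_of_nonpos hmpos.le (hνle e)
    linarith

end SemiBandit

theorem theorem1 {S : Type*} [MeasurableSpace S] (d m : ℕ) (hm : 1 ≤ m) (hmd : m ≤ d)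
    (hdvd : m ∣ d) (σ γ Δ : ℝ) (hσ : 0 < σ) (hγ0 : 0 ≤ γ) (hγ1 : γ ≤ 1) (hΔ : 0 < Δ)
    (π : SemiBandit.Algorithm d m S) (hπ : π.IsConsistent σ γ) :
    ∃ p : SemiBandit.Problem d m,
      (∀ A ∈ p.actionSet.actions, p.gap A = 0 ∨ p.gap A = Δ) ∧
      p.IsSubgaussianWith σ γ ∧
      (((1 + γ * ((m : ℝ) - 1)) * (2 * σ ^ 2 * ((d : ℝ) - (m : ℝ)) / Δ) : ℝ) : EReal) ≤
        liminf (fun t : ℕ => ((SemiBandit.expectedRegret π p t / Real.log (t : ℝ) : ℝ) : EReal))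
          atTop := by
  open SemiBandit in
  obtain ⟨k, rfl⟩ := hdvd
  have hk : k ≠ 0 := by rintro rfl; omega
  have : NeZero k := ⟨hk⟩
  have hm1 : (1 : ℝ) ≤ m := by exact_mod_cast hm
  have hmpos : (0 : ℝ) < m := by linarith
  have hκ : (0 : ℝ) < 1 + γ * (m - 1) := by
    have := mul_nonneg hγ0 (sub_nonneg.2 hm1)
    linarith
  set ν : Fin k → ℝ := fun c => if c = 0 then 0 else -Δ / m with hν
  have hgap (b : Fin k) : (blockProblem m k σ γ ν).gap (block m b) = if b = 0 then 0 else Δ := by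
    rw [blockProblem_gap σ γ ν (c := 0)]
    · by_cases hb : b = 0
      · simp [hb]
      · simp only [hν, hb, if_true, if_false]
        field_simp
        ring
    · intro c
      simp only [hν, if_true]
      split_ifs
      · rfl
      · rw [neg_div, neg_nonpos]; positivity
  refine ⟨blockProblem m k σ γ ν, fun A hA => ?_, blockProblem_isSubgaussianWith ν hσ hγ0 hγ1, ?_⟩
  · obtain ⟨b, _, rfl⟩ := Finset.mem_image.1 hA
    rw [hgap]
    split_ifs <;> simp
  set K : ℝ := (1 + γ * ((m : ℝ) - 1)) * (2 * σ ^ 2 * (((m * k : ℕ) : ℝ) - (m : ℝ)) / Δ) with hK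
  have hbound (a : ℝ) (ha : 0 < a) (ha1 : a < 1) :
      ((K * ((1 - 2 * a) / (1 + a) ^ 2) : ℝ) : EReal) ≤ liminf (fun t : ℕ =>
        ((expectedRegret π (blockProblem m k σ γ ν) t / Real.log (t : ℝ) : ℝ) : EReal)) atTop := by
    refine le_liminf_of_le (by isBoundedDefault) ?_
    have hall : ∀ᶠ T : ℕ in atTop, ∀ b : Fin k, b ≠ 0 → (1 - 2 * a) * Real.log T ≤
        (∫ ω, pullCount π (blockActions m k) (block m b) T ω
          ∂jointLaw π (blockProblem m k σ γ ν)) *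
          (Δ ^ 2 * (1 + a) ^ 2 / (2 * m * σ ^ 2 * (1 + γ * (m - 1)))) := by
      rw [eventually_all]
      intro b
      by_cases hb : b = 0
      · simp [hb]
      · filter_upwards [eventually_log_le_integral_pullCount_block hm hσ hγ0 hγ1 hΔ π hπ hb ha
          ha1] with T hT _ using hT
    filter_upwards [hall, eventually_gt_atTop 1] with T hT hT1
    have hlogpos : 0 < Real.log T := Real.log_pos (by exact_mod_cast hT1)
    refine EReal.coe_le_coe_iff.2 ((le_div_iff₀ hlogpos).2 ?_)
    refine le_trans ?_ (sum_mul_integral_pullCount_le_expectedRegret π (blockProblem m k σ γ ν)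
      (Finset.univ.erase (0 : Fin k)) (block_injective hm) (δ := Δ) (fun b hb => ?_) T)
    · have hterm : ∀ b ∈ Finset.univ.erase (0 : Fin k),
          (1 - 2 * a) * Real.log T * (2 * m * σ ^ 2 * (1 + γ * (m - 1))) / (Δ * (1 + a) ^ 2) ≤
          Δ * ∫ ω, pullCount π (blockProblem m k σ γ ν).actionSet (block m b) T ω
            ∂jointLaw π (blockProblem m k σ γ ν) := by
        intro b hb
        have h := hT b (Finset.ne_of_mem_erase hb)
        rw [← mul_div_assoc, le_div_iff₀ (by positivity)] at h
        rw [div_le_iff₀ (by positivity)]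
        refine h.trans_eq ?_
        change _ = Δ * (∫ ω, pullCount π (blockActions m k) (block m b) T ω
          ∂jointLaw π (blockProblem m k σ γ ν)) * _
        ring
      -- There are `k - 1` equal lower bounds, and their factor `m` turns `k - 1` into `d - m`.
      refine le_trans (le_of_eq ?_) (Finset.card_nsmul_le_sum _ _ _ hterm)
      rw [Finset.card_erase_of_mem (Finset.mem_univ _), Finset.card_univ, Fintype.card_fin,
        nsmul_eq_mul, Nat.cast_sub (Nat.one_le_iff_ne_zero.2 hk), hK]
      push_cast
      field_simp
    · rw [hgap, if_neg (Finset.ne_of_mem_erase hb)]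
  -- The problem does not depend on `a`; only the alternatives do, so `a` may tend to `0` at the
  -- end.
  have hlim : Tendsto (fun a : ℝ => ((K * ((1 - 2 * a) / (1 + a) ^ 2) : ℝ) : EReal))
      (nhdsWithin 0 (Set.Ioi 0)) (nhds (K : EReal)) := by
    refine (continuous_coe_real_ereal.tendsto K).comp ?_
    have hcont : ContinuousAt (fun a : ℝ => K * ((1 - 2 * a) / (1 + a) ^ 2)) 0 := by
      refine continuousAt_const.mul (ContinuousAt.div (by fun_prop) (by fun_prop) (by norm_num))
    have := hcont.tendsto
    simp only [mul_zero, sub_zero, add_zero, one_pow, div_one, mul_one] at this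
    exact this.mono_left nhdsWithin_le_nhds
  refine le_of_tendsto hlim ?_
  filter_upwards [Ioo_mem_nhdsGT (zero_lt_one (α := ℝ))] with a ha using hbound a ha.1 ha.2
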